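/- \textbf{Theorem (QED limits with retrials).} Consider a queue with $s\ge 1$ parallel servers, Poisson arrivals with rate $\lambda$ and i.i.d. exponential service times with mean one. A customer who finds a free server is admitted; a customer who finds $k\ge s$ customers in the system is admitted with probability $p_k\in[0,1]$ and rejected otherwise. The policy is held fixed as $s$ varies, i.e. $p_{s+n}=q_n$ for a sequence $(q_n)_{n\ge0}$ in $[0,1]$ not depending on $s$. Let $$F(x)=\sum_{n=0}^\infty p_s p_{s+1}\cdots p_{s+n}\,x^{n+1},\qquad P=\limsup_{n\to\infty}(p_s\cdots p_{s+n})^{1/(n+1)},$$ and assume $P\in[0,1)$ and $\lim_{x\uparrow 1/P}F(x)=\infty$ (with $1/P=\infty$ if $P=0$). For $0\le\lambda<s/P$ let $\pi$ be the stationary distribution of the number of customers in the system (a birth-and-death process with birth rates $\lambda p_k$, where $p_k=1$ for $k<s$, and death rates $\min(k,s)$), and let $$D_F(s,\lambda)=\sum_{k\ge s}\pi_k,\qquad D_F^R(s,\lambda)=\sum_{k\ge s}\pi_k(1-p_k)$$ be the stationary probabilities that an arriving customer finds all servers occupied, respectively is rejected. Let $\varphi,\Phi$ be the standard normal density and distribution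 function. Fix $\gamma>0$ and put $\lambda=s-\gamma\sqrt s$. For every $s$ with $\sqrt s\ge\gamma$ the generalized Cohen equation $$\Omega=(\lambda+\Omega)\,D_F^R(s,\lambda+\Omega)$$ has a unique solution $\Omega\ge 0$ with $\lambda+\Omega<s/P$. The equation $$a=\frac{\varphi(\gamma-a)}{\Phi(\gamma-a)}$$ has a unique positive solution $a$, and $$\lim_{s\to\infty}\frac{\Omega}{\sqrt s}=a.$$ Furthermore, with $\bar D_F(s,\lambda)=D_F(s,\lambda+\Omega)$ and $\bar D_F^R(s,\lambda)=D_F^R(s,\lambda+\Omega)$, $$\lim_{s\to\infty}\sqrt s\,\bar D_F(s,s-\gamma\sqrt s)=(1+F(1))\frac{\varphi(\gamma-a)}{\Phi(\gamma-a)},\qquad \lim_{s\to\infty}\sqrt s\,\bar D_F^R(s,s-\gamma\sqrt s)=\frac{\varphi(\gamma-a)}{\Phi(\gamma-a)}.$$ -/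

import Mathlib

open Filter Topology ProbabilityTheory

noncomputable section

namespace RetrialQueue

/-- Density of the standard normal distribution. -/
def phi (x : ℝ) : ℝ := gaussianPDFReal 0 1 x

/-- Cumulative distribution function of the standard normal distribution. -/
def Phi (x : ℝ) : ℝ := cdf (gaussianReal 0 1) x

/-! An admission policy is a sequence `q` in `[0, 1]`: in a system with `s` servers, `q n` is the
probability `p_{s+n}` that a customer who finds `s + n` customers in the system is admitted. -/

/-- `F(x) = ∑_{n ≥ 0} p_s ⋯ p_{s+n} x^{n+1}`. -/
def policySeries (q : ℕ → ℝ) (x : ℝ) : ℝ :=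
  ∑' n : ℕ, (∏ i ∈ Finset.range (n + 1), q i) * x ^ (n + 1)

/-- `P = limsup_n (p_s ⋯ p_{s+n})^{1/(n+1)}`, the inverse radius of convergence of `F`. -/
def policyP (q : ℕ → ℝ) : ℝ :=
  limsup (fun n : ℕ => (∏ i ∈ Finset.range (n + 1), q i) ^ (1 / ((n : ℝ) + 1))) atTop

/-- `P ∈ [0, 1)` and `F(x) → ∞` as `x ↑ 1/P`, where `1/P = ∞` if `P = 0`. -/
structure PolicyCondition (q : ℕ → ℝ) : Prop where
  mem_Ico : policyP q ∈ Set.Ico (0 : ℝ) 1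
  tendsto_of_pos : 0 < policyP q → Tendsto (policySeries q) (𝓝[<] (1 / policyP q)) atTop
  tendsto_of_zero : policyP q = 0 → Tendsto (policySeries q) atTop atTop

/-- The probability `p_k` that a customer who finds `k` customers in the system is admitted. -/
def admitProb (q : ℕ → ℝ) (s k : ℕ) : ℝ := if k < s then 1 else q (k - s)

/-- Birth rate of the number of customers in the system, at arrival rate `lam`. -/
def birthRate (q : ℕ → ℝ) (s : ℕ) (lam : ℝ) (k : ℕ) : ℝ := lam * admitProb q s k

/-- Death rate of the number of customers in the system; service times have mean one. -/
def deathRate (s k : ℕ) : ℝ := (min k s : ℕ)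

/-- The solution of the detailed balance equations with value `1` at `0`. -/
def weight (q : ℕ → ℝ) (s : ℕ) (lam : ℝ) (k : ℕ) : ℝ :=
  ∏ i ∈ Finset.range k, birthRate q s lam i / deathRate s (i + 1)

/-- The stationary distribution `π_k` of the number of customers in the system. -/
def stationaryDist (q : ℕ → ℝ) (s : ℕ) (lam : ℝ) (k : ℕ) : ℝ :=
  weight q s lam k / ∑' j, weight q s lam j

/-- `π` is a stationary distribution of the birth-and-death process: a probability vector with
`π Q = 0` for the generator `Q`. -/
structure IsStationary (q : ℕ → ℝ) (s : ℕ) (lam : ℝ) (π : ℕ → ℝ) : Prop where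
  nonneg : ∀ k, 0 ≤ π k
  hasSum : HasSum π 1
  balance_zero : π 0 * birthRate q s lam 0 = π 1 * deathRate s 1
  balance_succ : ∀ k, π (k + 1) * (birthRate q s lam (k + 1) + deathRate s (k + 1)) =
    π k * birthRate q s lam k + π (k + 2) * deathRate s (k + 2)

/-- The stability condition `lam ∈ [0, s / P)`, where `s / P = ∞` if `P = 0`. -/
def IsStable (q : ℕ → ℝ) (s : ℕ) (lam : ℝ) : Prop :=
  0 ≤ lam ∧ (0 < policyP q → lam < s / policyP q)

/-- `D_F(s, lam)`: stationary probability that an arriving customer finds all servers occupied. -/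
def delayProb (q : ℕ → ℝ) (s : ℕ) (lam : ℝ) : ℝ :=
  ∑' n : ℕ, stationaryDist q s lam (s + n)

/-- `D_F^R(s, lam)`: stationary probability that an arriving customer is rejected. -/
def rejectProb (q : ℕ → ℝ) (s : ℕ) (lam : ℝ) : ℝ :=
  ∑' n : ℕ, stationaryDist q s lam (s + n) * (1 - admitProb q s (s + n))

/-- `Om` is a solution of the generalized Cohen equation
`Om = (lam + Om) * D_F^R(s, lam + Om)`, with `lam + Om` in the stability region. -/
structure IsCohenSolution (q : ℕ → ℝ) (s : ℕ) (lam Om : ℝ) : Prop where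
  nonneg : 0 ≤ Om
  stable : IsStable q s (lam + Om)
  equation : Om = (lam + Om) * rejectProb q s (lam + Om)

theorem deathRate_succ_pos {s : ℕ} (hs : 0 < s) (k : ℕ) : 0 < deathRate s (k + 1) := by
  unfold deathRate
  exact_mod_cast lt_min (Nat.succ_pos k) hs

theorem weight_succ {s : ℕ} (hs : 0 < s) (q : ℕ → ℝ) (lam : ℝ) (k : ℕ) :
    weight q s lam (k + 1) * deathRate s (k + 1) = weight q s lam k * birthRate q s lam k := by
  have h := (deathRate_succ_pos hs k).ne'
  unfold weight
  rw [Finset.prod_range_succ]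
  field_simp

theorem weight_nonneg {q : ℕ → ℝ} (hq : ∀ n, q n ∈ Set.Icc (0 : ℝ) 1) (s : ℕ) {lam : ℝ}
    (hl : 0 ≤ lam) (k : ℕ) : 0 ≤ weight q s lam k := by
  refine Finset.prod_nonneg fun i _ => div_nonneg (mul_nonneg hl ?_) (Nat.cast_nonneg _)
  unfold admitProb
  split_ifs
  · exact zero_le_one
  · exact (hq _).1

/-- Whenever the weights are summable, `stationaryDist` is the unique stationary distribution of
the birth-and-death process. -/
theorem isStationary_iff {q : ℕ → ℝ} (hq : ∀ n, q n ∈ Set.Icc (0 : ℝ) 1) {s : ℕ} (hs : 0 < s)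
    {lam : ℝ} (hl : 0 ≤ lam) (hw : Summable (weight q s lam)) (π : ℕ → ℝ) :
    IsStationary q s lam π ↔ π = stationaryDist q s lam := by
  have h0 : weight q s lam 0 = 1 := by simp [weight]
  have hpos : 0 < ∑' j, weight q s lam j :=
    hw.tsum_pos (weight_nonneg hq s hl) 0 (by rw [h0]; exact one_pos)
  constructor
  · intro h
    have hdb : ∀ k, π (k + 1) * deathRate s (k + 1) = π k * birthRate q s lam k := by
      intro k
      induction k with
      | zero => exact h.balance_zero.symm
      | succ k ih => linarith [h.balance_succ k]
    have hk : ∀ k, π k = π 0 * weight q s lam k := by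
      intro k
      induction k with
      | zero => rw [h0, mul_one]
      | succ k ih =>
        apply mul_right_cancel₀ (deathRate_succ_pos hs k).ne'
        rw [hdb, mul_assoc, weight_succ hs, ih, mul_assoc]
    have hsum : π 0 * ∑' j, weight q s lam j = 1 := by
      rw [← tsum_mul_left, ← h.hasSum.tsum_eq]
      exact tsum_congr fun k => (hk k).symm
    funext k
    rw [hk k, stationaryDist, eq_div_iff hpos.ne', mul_right_comm, hsum, one_mul]
  · rintro rfl
    have hdb : ∀ k, stationaryDist q s lam (k + 1) * deathRate s (k + 1) =
        stationaryDist q s lam k * birthRate q s lam k := by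
      intro k
      unfold stationaryDist
      rw [div_mul_eq_mul_div, weight_succ hs, div_mul_eq_mul_div]
    refine ⟨fun k => div_nonneg (weight_nonneg hq s hl k) hpos.le, ?_, (hdb 0).symm, ?_⟩
    · have := hw.hasSum.div_const (∑' j, weight q s lam j)
      rwa [div_self hpos.ne'] at this
    · intro k
      linarith [hdb k, hdb (k + 1)]

end RetrialQueue

end

noncomputable section

namespace RetrialQueue

/-! Put `x = λ + Ω` and let `N(x)` be the stationary mean number of free servers, `freeServers s x /
totalWeight q s x`. Rate conservation gives `x * rejectProb q s x = x - (s - N(x))`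
(`mul_rejectProb_eq`), so the Cohen equation is simply `N(x) = s - λ`. The function `N` decreases
strictly, equals `s` at `0`, and gets arbitrarily small inside the stability region because `F`
diverges at `1/P`; hence existence and uniqueness.

For the limit write `x = s - b√s`. The integral representation of the inverse Erlang loss function,
rescaled by `√s`, shows that the idle part of `totalWeight` divided by `√s` times the weight of
state `s` tends to `Φ(b)/φ(b) = ∫_0^∞ exp(bu - u²/2) du`. States at or above `s` contribute only
order `1/√s`, since `1 + F` is continuous at `1`. Therefore `N(x)/√s → b + φ(b)/Φ(b)`. This limit is
the mean of a density on the half-line tilted by `b`, so it is strictly increasing in `b`. Since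
`N(x) = γ√s`, the scaled solution `b = γ - Ω/√s` must converge to the root `β` of `β + φ(β)/Φ(β) =
γ`, and `a = γ - β`. The delay and rejection limits follow by substitution. -/

/-- `p_s ⋯ p_{s+n-1}`, the product of the first `n` admission probabilities. -/
def admitProd (q : ℕ → ℝ) (n : ℕ) : ℝ := ∏ i ∈ Finset.range n, q i

/-- The power series `1 + F(x)`. -/
def waitSeries (q : ℕ → ℝ) (x : ℝ) : ℝ := ∑' n : ℕ, admitProd q n * x ^ n

/-! ### The power series `1 + F`. -/

section Series

variable {q : ℕ → ℝ}

theorem admitProd_nonneg (hq : ∀ n, q n ∈ Set.Icc (0 : ℝ) 1) (n : ℕ) : 0 ≤ admitProd q n :=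
  Finset.prod_nonneg fun i _ => (hq i).1

theorem admitProd_le_one (hq : ∀ n, q n ∈ Set.Icc (0 : ℝ) 1) (n : ℕ) : admitProd q n ≤ 1 :=
  Finset.prod_le_one (fun i _ => (hq i).1) fun i _ => (hq i).2

/-- Root test: with `ρ > P` and `xρ < 1`, the terms are eventually at most `(xρ)^n`. The bound
`admitProd ≤ 1` makes the real-valued limsup meaningful. -/
theorem summable_admitProd_mul_pow (hq : ∀ n, q n ∈ Set.Icc (0 : ℝ) 1) {x : ℝ} (hx : 0 ≤ x)
    (hxP : x * policyP q < 1) (hP : 0 ≤ policyP q) :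
    Summable fun n => admitProd q n * x ^ n := by
  obtain ⟨ρ, hρ1, hρ⟩ : ∃ ρ, x * ρ < 1 ∧ policyP q < ρ := by
    have h : ∀ᶠ ρ in 𝓝[>] policyP q, x * ρ < 1 :=
      nhdsWithin_le_nhds
        (((continuous_const.mul continuous_id).tendsto (policyP q)).eventually_lt_const hxP)
    exact (h.and self_mem_nhdsWithin).exists
  have hev : ∀ᶠ n : ℕ in atTop, (admitProd q (n + 1)) ^ (1 / ((n : ℝ) + 1)) < ρ := by
    refine eventually_lt_of_limsup_lt hρ ?_
    refine isBoundedUnder_of ⟨1, fun n => ?_⟩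
    exact Real.rpow_le_one (admitProd_nonneg hq _) (admitProd_le_one hq _) (by positivity)
  have hρ0 : 0 ≤ ρ := hP.trans hρ.le
  rw [← summable_nat_add_iff 1]
  refine Summable.of_norm_bounded_eventually_nat (g := fun n => (x * ρ) ^ (n + 1)) ?_ ?_
  · exact (summable_nat_add_iff 1).2 (summable_geometric_of_lt_one (by positivity) hρ1)
  · filter_upwards [hev] with n hn
    have h0 := admitProd_nonneg hq (n + 1)
    have h1 : admitProd q (n + 1) ≤ ρ ^ (n + 1) := by
      have h2 : (admitProd q (n + 1) ^ (1 / ((n : ℝ) + 1))) ^ (n + 1) = admitProd q (n + 1) := by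
        rw [← Real.rpow_natCast, ← Real.rpow_mul h0]
        push_cast
        rw [one_div_mul_cancel (by positivity), Real.rpow_one]
      rw [← h2]
      exact pow_le_pow_left₀ (by positivity) hn.le _
    rw [Real.norm_of_nonneg (by positivity), mul_pow, mul_comm]
    gcongr

theorem waitSeries_eq_one_add (hs : Summable fun n => admitProd q n * x ^ n) :
    waitSeries q x = 1 + policySeries q x := by
  unfold waitSeries
  rw [hs.tsum_eq_zero_add]
  simp [admitProd, policySeries]

theorem one_le_waitSeries (hq : ∀ n, q n ∈ Set.Icc (0 : ℝ) 1) {x : ℝ} (hx : 0 ≤ x)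
    (hs : Summable fun n => admitProd q n * x ^ n) : 1 ≤ waitSeries q x := by
  have := hs.le_tsum 0 fun n _ => mul_nonneg (admitProd_nonneg hq n) (pow_nonneg hx n)
  simpa [admitProd, waitSeries] using this

theorem waitSeries_mono (hq : ∀ n, q n ∈ Set.Icc (0 : ℝ) 1) {x y : ℝ} (hx : 0 ≤ x) (hxy : x ≤ y)
    (hs : Summable fun n => admitProd q n * y ^ n) : waitSeries q x ≤ waitSeries q y := by
  have hle : ∀ n, admitProd q n * x ^ n ≤ admitProd q n * y ^ n := fun n =>
    mul_le_mul_of_nonneg_left (pow_le_pow_left₀ hx hxy n) (admitProd_nonneg hq n)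
  exact (Summable.of_nonneg_of_le
    (fun n => mul_nonneg (admitProd_nonneg hq n) (pow_nonneg hx n)) hle hs).tsum_le_tsum hle hs

theorem continuousOn_waitSeries (hq : ∀ n, q n ∈ Set.Icc (0 : ℝ) 1) {R : ℝ}
    (hs : Summable fun n => admitProd q n * R ^ n) :
    ContinuousOn (waitSeries q) (Set.Icc 0 R) := by
  refine continuousOn_tsum (fun n => by fun_prop) hs fun n x hx => ?_
  rw [Real.norm_of_nonneg (mul_nonneg (admitProd_nonneg hq n) (pow_nonneg hx.1 n))]
  exact mul_le_mul_of_nonneg_left (pow_le_pow_left₀ hx.1 hx.2 n) (admitProd_nonneg hq n)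

/-- Since `P < 1`, the series converges uniformly on some `[0, R]` with `R > 1`. -/
theorem PolicyCondition.continuousAt_waitSeries_one (hq : ∀ n, q n ∈ Set.Icc (0 : ℝ) 1)
    (hF : PolicyCondition q) : ContinuousAt (waitSeries q) 1 := by
  obtain ⟨R, hR, h1⟩ : ∃ R, R * policyP q < 1 ∧ 1 < R := by
    have h : ∀ᶠ R in 𝓝[>] (1 : ℝ), R * policyP q < 1 :=
      nhdsWithin_le_nhds
        (((continuous_id.mul continuous_const).tendsto (1 : ℝ)).eventually_lt_const
          (by simpa using hF.mem_Ico.2))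
    exact (h.and self_mem_nhdsWithin).exists
  have hc := continuousOn_waitSeries hq
    (summable_admitProd_mul_pow hq (zero_le_one.trans h1.le) hR hF.mem_Ico.1)
  exact hc.continuousAt (Icc_mem_nhds one_pos h1)

/-- The form in which divergence at `1/P` is used: `sR` is then a stable arrival rate, at least `s`,
at which waiting dominates. -/
theorem PolicyCondition.exists_le_waitSeries (hq : ∀ n, q n ∈ Set.Icc (0 : ℝ) 1)
    (hF : PolicyCondition q) (C : ℝ) :
    ∃ R, 1 ≤ R ∧ R * policyP q < 1 ∧ C ≤ waitSeries q R := by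
  have key : ∃ R, 1 ≤ R ∧ R * policyP q < 1 ∧ C ≤ policySeries q R := by
    rcases hF.mem_Ico.1.eq_or_lt with h0 | h0
    · have h := (hF.tendsto_of_zero h0.symm).eventually_ge_atTop C
      obtain ⟨R, h1, h2⟩ := (h.and (eventually_ge_atTop 1)).exists
      exact ⟨R, h2, by simp [← h0], h1⟩
    · have h := (hF.tendsto_of_pos h0).eventually_ge_atTop C
      have h1 : ∀ᶠ R in 𝓝[<] (1 / policyP q), 1 < R :=
        nhdsWithin_le_nhds (lt_mem_nhds ((one_lt_div h0).2 hF.mem_Ico.2))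
      obtain ⟨R, ⟨h2, h3⟩, h4⟩ := ((h.and h1).and self_mem_nhdsWithin).exists
      exact ⟨R, h3.le, (lt_div_iff₀ h0).1 h4, h2⟩
  obtain ⟨R, h1, h2, h3⟩ := key
  refine ⟨R, h1, h2, ?_⟩
  rw [waitSeries_eq_one_add
    (summable_admitProd_mul_pow hq (zero_le_one.trans h1) h2 hF.mem_Ico.1)]
  linarith

end Series

/-! ### Truncated exponential sums and monotonicity of the mean number of free servers. -/

/-- `x^s / s!`. -/
def expTerm (s : ℕ) (x : ℝ) : ℝ := x ^ s / s.factorial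

/-- The truncated exponential series `∑_{k < s} x^k / k!`. -/
def expPartial (s : ℕ) (x : ℝ) : ℝ := ∑ k ∈ Finset.range s, expTerm k x

/-- The unnormalised expected number of free servers, `∑_{k < s} (s - k) x^k / k!`. -/
def freeServers (s : ℕ) (x : ℝ) : ℝ := ∑ j ∈ Finset.range s, expPartial (j + 1) x

theorem expTerm_nonneg (s : ℕ) {x : ℝ} (hx : 0 ≤ x) : 0 ≤ expTerm s x := by
  unfold expTerm; positivity

theorem expTerm_pos (s : ℕ) {x : ℝ} (hx : 0 < x) : 0 < expTerm s x := by
  unfold expTerm; positivity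

theorem expTerm_succ (s : ℕ) (x : ℝ) : (s + 1) * expTerm (s + 1) x = x * expTerm s x := by
  unfold expTerm
  rw [Nat.factorial_succ, pow_succ]
  push_cast
  field_simp

theorem expPartial_succ (s : ℕ) (x : ℝ) :
    expPartial (s + 1) x = expPartial s x + expTerm s x :=
  Finset.sum_range_succ _ _

theorem expPartial_nonneg (s : ℕ) {x : ℝ} (hx : 0 ≤ x) : 0 ≤ expPartial s x :=
  Finset.sum_nonneg fun _ _ => expTerm_nonneg _ hx

theorem expPartial_pos {s : ℕ} (hs : 0 < s) {x : ℝ} (hx : 0 ≤ x) : 0 < expPartial s x :=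
  Finset.sum_pos' (fun _ _ => expTerm_nonneg _ hx) ⟨0, by simpa using hs, by simp [expTerm]⟩

/-- The sum of partial sums suits termwise monotonicity arguments; this closed form serves the rate
balance and the asymptotics. -/
theorem freeServers_eq (s : ℕ) (x : ℝ) :
    freeServers s x = (s - x) * expPartial s x + s * expTerm s x := by
  induction s with
  | zero => simp [freeServers, expPartial]
  | succ s ih =>
    have h := expTerm_succ s x
    rw [freeServers, Finset.sum_range_succ, ← freeServers, ih, expPartial_succ]
    push_cast
    rw [h]
    ring

/-- Monotone likelihood ratio of the Poisson weights: `expTerm k / expTerm i` is a constant times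
`x^(k-i)`. The next three lemmas sum this over indices. -/
theorem expTerm_mul_expTerm_le {i k : ℕ} (hik : i ≤ k) {x y : ℝ} (hx : 0 ≤ x) (hxy : x ≤ y) :
    expTerm i y * expTerm k x ≤ expTerm i x * expTerm k y := by
  obtain ⟨d, rfl⟩ := Nat.exists_eq_add_of_le hik
  have hy := hx.trans hxy
  unfold expTerm
  rw [div_mul_div_comm, div_mul_div_comm]
  refine div_le_div_of_nonneg_right ?_ (by positivity)
  calc y ^ i * x ^ (i + d) = (y ^ i * x ^ i) * x ^ d := by ring
    _ ≤ (y ^ i * x ^ i) * y ^ d := by gcongr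
    _ = x ^ i * y ^ (i + d) := by ring

theorem expPartial_mul_expTerm_le {j k : ℕ} (hjk : j ≤ k + 1) {x y : ℝ} (hx : 0 ≤ x)
    (hxy : x ≤ y) : expPartial j y * expTerm k x ≤ expPartial j x * expTerm k y := by
  unfold expPartial
  rw [Finset.sum_mul, Finset.sum_mul]
  refine Finset.sum_le_sum fun i hi => expTerm_mul_expTerm_le ?_ hx hxy
  have := Finset.mem_range.1 hi
  omega

theorem expPartial_mul_expTerm_lt {j k : ℕ} (hj : 0 < j) (hjk : j ≤ k) {x y : ℝ} (hx : 0 ≤ x)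
    (hxy : x < y) : expPartial j y * expTerm k x < expPartial j x * expTerm k y := by
  unfold expPartial
  rw [Finset.sum_mul, Finset.sum_mul]
  -- Strictness comes from the index `0`, where it reads `x^k < y^k` with `k ≥ j > 0`.
  refine Finset.sum_lt_sum (fun i hi => expTerm_mul_expTerm_le ?_ hx hxy.le)
    ⟨0, by simpa using hj, ?_⟩
  · have := Finset.mem_range.1 hi
    omega
  · simp only [expTerm, pow_zero, Nat.factorial_zero, Nat.cast_one, div_one, one_mul]
    have := pow_lt_pow_left₀ hxy hx (hj.trans_le hjk).ne'
    gcongr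

theorem expPartial_mul_expPartial_le {j s : ℕ} (hjs : j ≤ s) {x y : ℝ} (hx : 0 ≤ x)
    (hxy : x ≤ y) : expPartial j y * expPartial s x ≤ expPartial j x * expPartial s y := by
  induction s, hjs using Nat.le_induction with
  | base => exact (mul_comm _ _).le
  | succ s hs ih =>
    rw [expPartial_succ, expPartial_succ, mul_add, mul_add]
    exact add_le_add ih (expPartial_mul_expTerm_le (by omega) hx hxy)

/-- The normalising constant of the stationary distribution. -/
def totalWeight (q : ℕ → ℝ) (s : ℕ) (x : ℝ) : ℝ :=
  expPartial s x + expTerm s x * waitSeries q (x / s)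

theorem totalWeight_pos {q : ℕ → ℝ} (hq : ∀ n, q n ∈ Set.Icc (0 : ℝ) 1) {s : ℕ} (hs : 0 < s)
    {x : ℝ} (hx : 0 ≤ x) : 0 < totalWeight q s x := by
  refine add_pos_of_pos_of_nonneg (expPartial_pos hs hx) (mul_nonneg (expTerm_nonneg _ hx) ?_)
  exact tsum_nonneg fun n => mul_nonneg (admitProd_nonneg hq n) (by positivity)

/-- The expected number of free servers is strictly decreasing in the arrival rate. -/
theorem freeServers_div_totalWeight_lt {q : ℕ → ℝ} (hq : ∀ n, q n ∈ Set.Icc (0 : ℝ) 1) {s : ℕ}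
    (hs : 0 < s) {x y : ℝ} (hx : 0 ≤ x) (hxy : x < y)
    (hsum : Summable fun n => admitProd q n * (y / s) ^ n) :
    freeServers s y / totalWeight q s y < freeServers s x / totalWeight q s x := by
  have hy := hx.trans hxy.le
  rw [div_lt_div_iff₀ (totalWeight_pos hq hs hy) (totalWeight_pos hq hs hx)]
  unfold freeServers
  rw [Finset.sum_mul, Finset.sum_mul]
  -- Each partial sum, divided by `totalWeight`, already decreases strictly; a larger waiting series
  -- only helps.
  refine Finset.sum_lt_sum_of_nonempty ⟨0, by simpa using hs⟩ fun j hj => ?_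
  have hjs : j + 1 ≤ s := Finset.mem_range.1 hj
  have h1 := expPartial_mul_expPartial_le hjs hx hxy.le
  have h2 := expPartial_mul_expTerm_lt (Nat.succ_pos j) hjs hx hxy
  have h3 : waitSeries q (x / s) ≤ waitSeries q (y / s) :=
    waitSeries_mono hq (by positivity) (by gcongr) hsum
  have h4 : 1 ≤ waitSeries q (y / s) := one_le_waitSeries hq (by positivity) hsum
  have h5 : 0 ≤ expPartial (j + 1) y * expTerm s x :=
    mul_nonneg (expPartial_nonneg _ hy) (expTerm_nonneg _ hx)
  unfold totalWeight
  calc _ = expPartial (j + 1) y * expPartial s x +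
        (expPartial (j + 1) y * expTerm s x) * waitSeries q (x / s) := by ring
    _ ≤ expPartial (j + 1) y * expPartial s x +
        (expPartial (j + 1) y * expTerm s x) * waitSeries q (y / s) := by gcongr
    _ < expPartial (j + 1) x * expPartial s y +
        (expPartial (j + 1) x * expTerm s y) * waitSeries q (y / s) :=
      add_lt_add_of_le_of_lt h1 (mul_lt_mul_of_pos_right h2 (one_pos.trans_le h4))
    _ = _ := by ring

/-! ### Closed forms for the stationary distribution. -/

section Stationary

variable {q : ℕ → ℝ} {s : ℕ} {x : ℝ}

theorem weight_of_le (hks : k ≤ s) : weight q s x k = expTerm k x := by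
  induction k with
  | zero => simp [weight, expTerm]
  | succ k ih =>
    have h := weight_succ (by omega : 0 < s) q x k
    have hd : deathRate s (k + 1) = k + 1 := by
      rw [deathRate, min_eq_left hks]; push_cast; ring
    rw [ih (by omega), birthRate, admitProb, if_pos (by omega), hd, mul_one, mul_comm,
      mul_comm (expTerm k x), ← expTerm_succ] at h
    exact mul_left_cancel₀ (by positivity) h

theorem admitProb_add (q : ℕ → ℝ) (s n : ℕ) : admitProb q s (s + n) = q n := by
  simp [admitProb]

theorem weight_add (hs : 0 < s) (n : ℕ) :
    weight q s x (s + n) = expTerm s x * (admitProd q n * (x / s) ^ n) := by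
  induction n with
  | zero => simp [weight_of_le le_rfl, admitProd]
  | succ n ih =>
    have h := weight_succ hs q x (s + n)
    have hd : deathRate s (s + n + 1) = s := by
      rw [deathRate, min_eq_right (by omega)]
    rw [ih, birthRate, admitProb_add, hd] at h
    have hs' : (s : ℝ) ≠ 0 := by positivity
    rw [← add_assoc]
    apply mul_right_cancel₀ hs'
    rw [h, admitProd, admitProd, Finset.prod_range_succ, pow_succ]
    field_simp

theorem tsum_weight (hs : 0 < s) (hsum : Summable fun n => admitProd q n * (x / s) ^ n) :
    ∑' k, weight q s x k = totalWeight q s x := by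
  have h : Summable (weight q s x) := by
    rw [← summable_nat_add_iff s]
    refine (hsum.mul_left (expTerm s x)).congr fun n => ?_
    rw [add_comm, weight_add hs]
  rw [← h.sum_add_tsum_nat_add s, totalWeight, expPartial, waitSeries, ← tsum_mul_left]
  congr 1
  · exact Finset.sum_congr rfl fun k hk => weight_of_le (Finset.mem_range.1 hk).le
  · exact tsum_congr fun n => by rw [add_comm, weight_add hs]

theorem delayProb_eq (hs : 0 < s) (hsum : Summable fun n => admitProd q n * (x / s) ^ n) :
    delayProb q s x = expTerm s x * waitSeries q (x / s) / totalWeight q s x := by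
  unfold delayProb stationaryDist
  rw [tsum_weight hs hsum, tsum_div_const, waitSeries, ← tsum_mul_left]
  simp only [weight_add hs]

/-- The rate of rejections is the arrival rate minus the expected number of busy servers. -/
theorem mul_rejectProb_eq (hq : ∀ n, q n ∈ Set.Icc (0 : ℝ) 1) (hs : 0 < s) (hx : 0 ≤ x)
    (hsum : Summable fun n => admitProd q n * (x / s) ^ n) :
    x * rejectProb q s x = x - (s - freeServers s x / totalWeight q s x) := by
  have hD := (totalWeight_pos hq hs hx).ne'
  have hs' : (s : ℝ) ≠ 0 := by positivity
  have hr : rejectProb q s x = (∑' n, weight q s x (s + n) * (1 - q n)) / totalWeight q s x := by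
    unfold rejectProb stationaryDist
    rw [tsum_weight hs hsum, ← tsum_div_const]
    refine tsum_congr fun n => ?_
    rw [admitProb_add]
    ring
  have hsum1 := (summable_nat_add_iff 1).2 hsum
  have h1 : ∑' n, admitProd q (n + 1) * (x / s) ^ (n + 1) = waitSeries q (x / s) - 1 := by
    rw [waitSeries, hsum.tsum_eq_zero_add]
    simp [admitProd]
  -- Detailed balance: `x` times the admitted part of term `n` is `s` times term `n + 1`, so the
  -- admitted flow is the series without its first term.
  have h2 : x * ∑' n, weight q s x (s + n) * (1 - q n) =
      expTerm s x * (x * waitSeries q (x / s) - s * (waitSeries q (x / s) - 1)) := by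
    rw [← h1, waitSeries, ← tsum_mul_left, ← tsum_mul_left, ← tsum_mul_left,
      ← (hsum.mul_left x).tsum_sub (hsum1.mul_left (s : ℝ)), ← tsum_mul_left]
    refine tsum_congr fun n => ?_
    rw [weight_add hs, admitProd, admitProd, Finset.prod_range_succ, pow_succ]
    field_simp
  rw [hr, ← mul_div_assoc, h2, freeServers_eq]
  field_simp
  unfold totalWeight
  ring

end Stationary

/-! ### Existence and uniqueness for the Cohen equation. -/

section Cohen

variable {q : ℕ → ℝ} {s : ℕ}

theorem isStable_iff (hP : 0 ≤ policyP q) (hs : 0 < s) (x : ℝ) :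
    IsStable q s x ↔ 0 ≤ x ∧ x / s * policyP q < 1 := by
  refine and_congr_right fun _ => ?_
  have hs' : (0 : ℝ) < s := by exact_mod_cast hs
  rcases hP.eq_or_lt with h | h
  · simp [← h]
  · rw [lt_div_iff₀ h, div_mul_eq_mul_div, div_lt_one hs']
    simp [h]

theorem IsStable.summable (hq : ∀ n, q n ∈ Set.Icc (0 : ℝ) 1) (hF : PolicyCondition q)
    (hs : 0 < s) {x : ℝ} (hx : IsStable q s x) :
    Summable fun n => admitProd q n * (x / s) ^ n := by
  have h := (isStable_iff hF.mem_Ico.1 hs x).1 hx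
  exact summable_admitProd_mul_pow hq (div_nonneg h.1 (Nat.cast_nonneg s)) h.2 hF.mem_Ico.1

/-- The Cohen equation says that the expected number of busy servers is the external arrival
rate. -/
theorem isCohenSolution_iff (hq : ∀ n, q n ∈ Set.Icc (0 : ℝ) 1) (hF : PolicyCondition q)
    (hs : 0 < s) {lam Om : ℝ} :
    IsCohenSolution q s lam Om ↔ IsStable q s (lam + Om) ∧
      freeServers s (lam + Om) / totalWeight q s (lam + Om) = s - lam := by
  constructor
  · intro h
    refine ⟨h.stable, ?_⟩
    have h1 := mul_rejectProb_eq hq hs h.stable.1 (h.stable.summable hq hF hs)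
    have h2 := h.equation
    linarith
  · rintro ⟨h, h2⟩
    have h1 := mul_rejectProb_eq hq hs h.1 (h.summable hq hF hs)
    have h3 : Om = (lam + Om) * rejectProb q s (lam + Om) := by linarith
    -- The sign of `Om` is automatic: the equation equates it to a rejection rate.
    have h4 : 0 ≤ rejectProb q s (lam + Om) := by
      refine tsum_nonneg fun n => mul_nonneg (div_nonneg (weight_nonneg hq s h.1 _)
        (tsum_nonneg fun k => weight_nonneg hq s h.1 k)) ?_
      rw [admitProb_add]
      linarith [(hq n).2]
    exact ⟨by rw [h3]; exact mul_nonneg h.1 h4, h, h3⟩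

theorem IsStable.freeServers_div_lt (hq : ∀ n, q n ∈ Set.Icc (0 : ℝ) 1) (hF : PolicyCondition q)
    (hs : 0 < s) {x y : ℝ} (hx : 0 ≤ x) (hxy : x < y) (hy : IsStable q s y) :
    freeServers s y / totalWeight q s y < freeServers s x / totalWeight q s x :=
  freeServers_div_totalWeight_lt hq hs hx hxy (hy.summable hq hF hs)

theorem continuous_expTerm (s : ℕ) : Continuous (expTerm s) := by
  unfold expTerm; fun_prop

theorem continuous_expPartial (s : ℕ) : Continuous (expPartial s) :=
  continuous_finsetSum _ fun k _ => continuous_expTerm k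

theorem continuous_freeServers (s : ℕ) : Continuous (freeServers s) :=
  continuous_finsetSum _ fun k _ => continuous_expPartial (k + 1)

theorem exists_freeServers_div_eq (hq : ∀ n, q n ∈ Set.Icc (0 : ℝ) 1) (hF : PolicyCondition q)
    (hs : 0 < s) {c : ℝ} (hc : 0 < c) (hcs : c ≤ s) :
    ∃ x, IsStable q s x ∧ freeServers s x / totalWeight q s x = c := by
  have hs' : (0 : ℝ) < s := by exact_mod_cast hs
  have hA := expTerm_pos s hs'
  -- The ratio `freeServers / expTerm s` decreases, so `N(sR)` is at most `freeServers s s /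
  -- (expTerm s s * waitSeries q R)`; the threshold makes this at most `c`.
  obtain ⟨R, hR1, hRP, hR⟩ := hF.exists_le_waitSeries hq (freeServers s s / (expTerm s s * c))
  have hR0 : 0 ≤ R := zero_le_one.trans hR1
  have hsR : (s : ℝ) ≤ s * R := le_mul_of_one_le_right hs'.le hR1
  have hX : 0 ≤ s * R := by positivity
  have hsum := summable_admitProd_mul_pow hq hR0 hRP hF.mem_Ico.1
  have hcont : ContinuousOn (fun x => freeServers s x / totalWeight q s x)
      (Set.Icc 0 (s * R)) := by
    refine (continuous_freeServers s).continuousOn.div ?_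
      fun x hx => (totalWeight_pos hq hs hx.1).ne'
    refine (continuous_expPartial s).continuousOn.add
      ((continuous_expTerm s).continuousOn.mul ?_)
    refine (continuousOn_waitSeries hq hsum).comp (by fun_prop) fun x hx => ?_
    exact ⟨div_nonneg hx.1 hs'.le, (div_le_iff₀ hs').2 (by linarith [hx.2])⟩
  have h0 : c ≤ freeServers s 0 / totalWeight q s 0 := by
    have hz : expTerm s 0 = 0 := by simp [expTerm, hs.ne']
    rw [freeServers_eq, totalWeight, hz]
    simp only [sub_zero, mul_zero, add_zero, zero_mul]
    rwa [mul_div_cancel_right₀ _ (expPartial_pos hs le_rfl).ne']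
  have h1 : freeServers s (s * R) / totalWeight q s (s * R) ≤ c := by
    rw [div_le_iff₀ (totalWeight_pos hq hs hX)]
    have h2 : freeServers s (s * R) * expTerm s s ≤ freeServers s s * expTerm s (s * R) := by
      unfold freeServers
      rw [Finset.sum_mul, Finset.sum_mul]
      refine Finset.sum_le_sum fun j hj => expPartial_mul_expTerm_le ?_ hs'.le hsR
      have := Finset.mem_range.1 hj
      omega
    rw [div_le_iff₀ (by positivity)] at hR
    have h3 : 0 ≤ expTerm s (s * R) := expTerm_nonneg s hX
    have h4 : 0 ≤ expPartial s (s * R) := expPartial_nonneg s hX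
    rw [totalWeight, mul_div_cancel_left₀ _ hs'.ne']
    refine le_of_mul_le_mul_right (h2.trans ?_) hA
    calc _ ≤ waitSeries q R * (expTerm s s * c) * expTerm s (s * R) := by gcongr
      _ ≤ waitSeries q R * (expTerm s s * c) * expTerm s (s * R) +
          c * expPartial s (s * R) * expTerm s s := le_add_of_nonneg_right (by positivity)
      _ = _ := by ring
  obtain ⟨x, hx, hxc⟩ := intermediate_value_Icc' hX hcont ⟨h1, h0⟩
  refine ⟨x, (isStable_iff hF.mem_Ico.1 hs x).2 ⟨hx.1, lt_of_le_of_lt ?_ hRP⟩, hxc⟩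
  refine mul_le_mul_of_nonneg_right ((div_le_iff₀ hs').2 ?_) hF.mem_Ico.1
  linarith [hx.2]

theorem existsUnique_isCohenSolution (hq : ∀ n, q n ∈ Set.Icc (0 : ℝ) 1) (hF : PolicyCondition q)
    (hs : 0 < s) {lam : ℝ} (hlam : 0 ≤ lam) (hlams : lam < s) :
    ∃! Om, IsCohenSolution q s lam Om := by
  obtain ⟨x, hx, hxc⟩ := exists_freeServers_div_eq hq hF hs (sub_pos.2 hlams)
    (sub_le_self _ hlam)
  refine ⟨x - lam, (isCohenSolution_iff hq hF hs).2 (by simpa using ⟨hx, hxc⟩), fun Om hOm => ?_⟩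
  obtain ⟨h1, h2⟩ := (isCohenSolution_iff hq hF hs).1 hOm
  rcases lt_trichotomy (lam + Om) x with h | h | h
  · exact absurd (hx.freeServers_div_lt hq hF hs h1.1 h) (by rw [hxc, h2]; exact lt_irrefl _)
  · linarith
  · exact absurd (h1.freeServers_div_lt hq hF hs hx.1 h) (by rw [hxc, h2]; exact lt_irrefl _)

end Cohen

/-! ### Half-line Gaussian moments and the inverse Mills ratio. -/

section Gaussian

open MeasureTheory Set

/-- The half-line Gaussian moments `∫_0^∞ u^k exp (b u - u² / 2) du`. -/
def halfMoment (k : ℕ) (b : ℝ) : ℝ := ∫ u in Ioi (0 : ℝ), u ^ k * Real.exp (b * u - u ^ 2 / 2)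

/-- Completing the square; the bound reduces integrability and decay to those of `u^k exp (-u)`. -/
theorem exp_linear_sub_sq_le (b u : ℝ) :
    Real.exp (b * u - u ^ 2 / 2) ≤ Real.exp ((b + 1) ^ 2 / 2) * Real.exp (-u) := by
  rw [← Real.exp_add, Real.exp_le_exp]
  nlinarith [sq_nonneg (u - (b + 1))]

theorem integrableOn_pow_mul_exp_neg (k : ℕ) :
    IntegrableOn (fun u : ℝ => u ^ k * Real.exp (-u)) (Ioi 0) := by
  refine (Real.GammaIntegral_convergent (s := k + 1) (by positivity)).congr_fun
    (fun u _ => ?_) measurableSet_Ioi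
  simp [mul_comm]

theorem integrableOn_halfMoment (k : ℕ) (b : ℝ) :
    IntegrableOn (fun u : ℝ => u ^ k * Real.exp (b * u - u ^ 2 / 2)) (Ioi 0) := by
  refine ((integrableOn_pow_mul_exp_neg k).const_mul (Real.exp ((b + 1) ^ 2 / 2))).mono'
    (by fun_prop) ?_
  refine (ae_restrict_iff' measurableSet_Ioi).2 (.of_forall fun u (hu : 0 < u) => ?_)
  rw [Real.norm_of_nonneg (by positivity), mul_left_comm]
  exact mul_le_mul_of_nonneg_left (exp_linear_sub_sq_le b u) (by positivity)

theorem tendsto_pow_mul_exp_linear_sub_sq (k : ℕ) (b : ℝ) :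
    Tendsto (fun u : ℝ => u ^ k * Real.exp (b * u - u ^ 2 / 2)) atTop (𝓝 0) := by
  have h := (Real.tendsto_pow_mul_exp_neg_atTop_nhds_zero k).const_mul (Real.exp ((b + 1) ^ 2 / 2))
  rw [mul_zero] at h
  refine squeeze_zero' ?_ ?_ h
  · filter_upwards [eventually_ge_atTop 0] with u hu
    positivity
  · filter_upwards [eventually_ge_atTop 0] with u hu
    rw [mul_left_comm]
    exact mul_le_mul_of_nonneg_left (exp_linear_sub_sq_le b u) (by positivity)

theorem hasDerivAt_exp_linear_sub_sq (b u : ℝ) :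
    HasDerivAt (fun u : ℝ => Real.exp (b * u - u ^ 2 / 2))
      (Real.exp (b * u - u ^ 2 / 2) * (b - u)) u := by
  have h : HasDerivAt (fun u : ℝ => b * u - u ^ 2 / 2) (b - u) u := by
    refine (((hasDerivAt_id' u).const_mul b).sub
      ((hasDerivAt_pow 2 u).div_const 2)).congr_deriv ?_
    norm_num
  exact h.exp

/-- Integrate the derivative of `exp (b u - u² / 2)`; the `1` is its value at `0`. The second moment
uses `u` times this function. -/
theorem halfMoment_one (b : ℝ) : halfMoment 1 b = b * halfMoment 0 b + 1 := by
  have h0 := integrableOn_halfMoment 0 b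
  have h1 := integrableOn_halfMoment 1 b
  have h := integral_Ioi_of_hasDerivAt_of_tendsto' (a := 0)
    (f := fun u : ℝ => Real.exp (b * u - u ^ 2 / 2))
    (f' := fun u => b * (u ^ 0 * Real.exp (b * u - u ^ 2 / 2)) -
      u ^ 1 * Real.exp (b * u - u ^ 2 / 2)) (m := 0)
    (fun u _ => (hasDerivAt_exp_linear_sub_sq b u).congr_deriv (by ring))
    (Integrable.sub' (h0.const_mul b) h1) (by simpa using tendsto_pow_mul_exp_linear_sub_sq 0 b)
  rw [integral_sub (h0.const_mul b) h1, integral_const_mul] at h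
  unfold halfMoment
  norm_num at h ⊢
  linarith

theorem halfMoment_two (b : ℝ) : halfMoment 2 b = b * halfMoment 1 b + halfMoment 0 b := by
  have h0 := integrableOn_halfMoment 0 b
  have h1 := integrableOn_halfMoment 1 b
  have h2 := integrableOn_halfMoment 2 b
  have h := integral_Ioi_of_hasDerivAt_of_tendsto' (a := 0)
    (f := fun u : ℝ => u * Real.exp (b * u - u ^ 2 / 2))
    (f' := fun u => u ^ 0 * Real.exp (b * u - u ^ 2 / 2) +
      b * (u ^ 1 * Real.exp (b * u - u ^ 2 / 2)) -
      u ^ 2 * Real.exp (b * u - u ^ 2 / 2)) (m := 0)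
    (fun u _ => ((hasDerivAt_id' u).mul (hasDerivAt_exp_linear_sub_sq b u)).congr_deriv (by ring))
    (Integrable.sub' (Integrable.fun_add h0 (h1.const_mul b)) h2) (by simpa using tendsto_pow_mul_exp_linear_sub_sq 1 b)
  rw [integral_sub (Integrable.fun_add h0 (h1.const_mul b)) h2, integral_add h0 (h1.const_mul b),
    integral_const_mul] at h
  unfold halfMoment
  norm_num at h ⊢
  linarith

/-- The exceptional point `c` accommodates an integrand that vanishes at the mean in
`halfMoment_div_lt`. -/
theorem setIntegral_Ioi_pos {f : ℝ → ℝ} (hf : IntegrableOn f (Ioi 0)) {c : ℝ}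
    (h0 : ∀ u, 0 ≤ u → u ≠ c → 0 < f u) (hc : 0 ≤ f c) : 0 < ∫ u in Ioi (0 : ℝ), f u := by
  rw [setIntegral_pos_iff_support_of_nonneg_ae ?_ hf]
  · refine lt_of_lt_of_le ?_ (measure_mono (s := Ioi (max 0 c)) fun u hu => ?_)
    · simp
    · have h1 : 0 < u := (le_max_left 0 c).trans_lt hu
      exact ⟨(h0 u h1.le ((le_max_right 0 c).trans_lt hu).ne').ne', h1⟩
  · refine (ae_restrict_iff' measurableSet_Ioi).2 (.of_forall fun u (hu : 0 < u) => ?_)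
    rcases eq_or_ne u c with rfl | h
    · exact hc
    · exact (h0 u hu.le h).le

theorem halfMoment_pos (k : ℕ) (b : ℝ) : 0 < halfMoment k b :=
  setIntegral_Ioi_pos (c := 0) (integrableOn_halfMoment k b)
    (fun u h h' => by have := h.lt_of_ne' h'; positivity) (by positivity)

/-- A covariance inequality: with `d` the mean at `b`, the function `(u - d)(exp ((c-b)u) - exp
((c-b)d)) exp (b u - u²/2)` is positive off `u = d`. By the choice of `d` its integral is
`halfMoment 1 c - d * halfMoment 0 c`. -/
theorem halfMoment_div_lt {b c : ℝ} (hbc : b < c) :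
    halfMoment 1 b / halfMoment 0 b < halfMoment 1 c / halfMoment 0 c := by
  set d := halfMoment 1 b / halfMoment 0 b with hd
  have hb := halfMoment_pos 0 b
  have hint : ∀ a, IntegrableOn (fun u : ℝ => u ^ 1 * Real.exp (a * u - u ^ 2 / 2) -
      d * (u ^ 0 * Real.exp (a * u - u ^ 2 / 2))) (Ioi 0) := fun a =>
    Integrable.sub' (integrableOn_halfMoment 1 a) ((integrableOn_halfMoment 0 a).const_mul d)
  have hval : ∀ a, ∫ u in Ioi (0 : ℝ), (u ^ 1 * Real.exp (a * u - u ^ 2 / 2) -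
      d * (u ^ 0 * Real.exp (a * u - u ^ 2 / 2))) = halfMoment 1 a - d * halfMoment 0 a := by
    intro a
    rw [integral_sub (integrableOn_halfMoment 1 a) ((integrableOn_halfMoment 0 a).const_mul d),
      integral_const_mul, halfMoment, halfMoment]
  have hpos := setIntegral_Ioi_pos (c := d)
    ((hint c).sub ((hint b).const_mul (Real.exp ((c - b) * d)))) (fun u _ hu => ?_) ?_
  · simp only [Pi.sub_apply] at hpos
    rw [integral_sub (hint c) ((hint b).const_mul _), integral_const_mul, hval, hval,
      hd, div_mul_cancel₀ _ hb.ne', sub_self, mul_zero, sub_zero, ← hd] at hpos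
    rw [lt_div_iff₀ (halfMoment_pos 0 c)]
    linarith
  · have h1 : Real.exp (c * u - u ^ 2 / 2) =
        Real.exp ((c - b) * u) * Real.exp (b * u - u ^ 2 / 2) := by
      rw [← Real.exp_add]; ring_nf
    have h2 : 0 < (u - d) * (Real.exp ((c - b) * u) - Real.exp ((c - b) * d)) := by
      rcases hu.lt_or_gt with h | h
      · exact mul_pos_of_neg_of_neg (sub_neg.2 h)
          (sub_neg.2 (Real.exp_lt_exp.2 (mul_lt_mul_of_pos_left h (sub_pos.2 hbc))))
      · exact mul_pos (sub_pos.2 h)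
          (sub_pos.2 (Real.exp_lt_exp.2 (mul_lt_mul_of_pos_left h (sub_pos.2 hbc))))
    have h3 := mul_pos h2 (Real.exp_pos (b * u - u ^ 2 / 2))
    simp only [Pi.sub_apply]
    rw [h1]
    linarith
  · simp

theorem continuous_halfMoment_zero : Continuous (halfMoment 0) := by
  refine continuous_iff_continuousAt.2 fun b => ?_
  refine continuousAt_of_dominated (bound := fun u => u ^ 0 *
    Real.exp ((b + 1) * u - u ^ 2 / 2)) (.of_forall fun a => by fun_prop) ?_
    (integrableOn_halfMoment 0 (b + 1)) (.of_forall fun u => by fun_prop)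
  filter_upwards [eventually_le_nhds (lt_add_one b)] with a ha
  refine (ae_restrict_iff' measurableSet_Ioi).2 (.of_forall fun u (hu : 0 < u) => ?_)
  rw [Real.norm_of_nonneg (by positivity)]
  gcongr

/-- The inverse Mills ratio `φ / Φ`. -/
theorem phi_div_Phi (b : ℝ) : phi b / Phi b = 1 / halfMoment 0 b := by
  have hphi : 0 < phi b := gaussianPDFReal_pos 0 1 b one_ne_zero
  have h1 : Phi b = ∫ t in Iic b, gaussianPDFReal 0 1 t := by
    rw [Phi, cdf_eq_real, Measure.real, gaussianReal_apply_eq_integral 0 one_ne_zero,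
      ENNReal.toReal_ofReal (setIntegral_nonneg measurableSet_Iic
        fun t _ => gaussianPDFReal_nonneg 0 1 t)]
  have h2 : ∫ t in Iic b, gaussianPDFReal 0 1 t =
      ∫ u in Ioi (0 : ℝ), gaussianPDFReal 0 1 (b - u) := by
    rw [← (Measure.measurePreserving_sub_left volume b).setIntegral_preimage_emb
      (MeasurableEquiv.subLeft b).measurableEmbedding, ← integral_Ici_eq_integral_Ioi]
    simp
  have h3 : Phi b = phi b * halfMoment 0 b := by
    rw [h1, h2, halfMoment, ← integral_const_mul]
    refine setIntegral_congr_fun measurableSet_Ioi fun u _ => ?_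
    simp only [phi, gaussianPDFReal, pow_zero, one_mul, sub_zero, NNReal.coe_one, mul_one]
    rw [mul_assoc, ← Real.exp_add]
    ring_nf
  rw [h3, div_mul_eq_div_div, div_self hphi.ne']

theorem add_one_div_halfMoment (b : ℝ) :
    b + 1 / halfMoment 0 b = halfMoment 1 b / halfMoment 0 b := by
  have := (halfMoment_pos 0 b).ne'
  rw [halfMoment_one]
  field_simp

theorem add_phi_div_Phi_lt {b c : ℝ} (hbc : b < c) :
    b + phi b / Phi b < c + phi c / Phi c := by
  rw [phi_div_Phi, phi_div_Phi, add_one_div_halfMoment, add_one_div_halfMoment]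
  exact halfMoment_div_lt hbc

theorem phi_div_Phi_pos (b : ℝ) : 0 < phi b / Phi b := by
  rw [phi_div_Phi]
  exact one_div_pos.2 (halfMoment_pos 0 b)

theorem exists_add_phi_div_Phi_eq {γ : ℝ} (hγ : 0 < γ) :
    ∃ b, b + phi b / Phi b = γ := by
  have hc : Continuous fun b => b + phi b / Phi b := by
    simp only [phi_div_Phi]
    exact continuous_id.add
      (continuous_const.div continuous_halfMoment_zero fun b => (halfMoment_pos 0 b).ne')
  have h1 : γ ≤ γ + phi γ / Phi γ := le_add_of_nonneg_right (phi_div_Phi_pos γ).le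
  -- At `b = -1/γ`, positivity of the second moment `b m₁ + m₀` says exactly `m₁ < γ m₀`.
  have h2 : -(1 / γ) + phi (-(1 / γ)) / Phi (-(1 / γ)) ≤ γ := by
    rw [phi_div_Phi, add_one_div_halfMoment, div_le_iff₀ (halfMoment_pos 0 _)]
    have h := halfMoment_pos 2 (-(1 / γ))
    rw [halfMoment_two] at h
    have h3 := mul_pos hγ h
    have h4 : γ * (1 / γ) = 1 := by field_simp
    rw [mul_add, ← mul_assoc, mul_neg, h4] at h3
    linarith
  exact mem_range_of_exists_le_of_exists_ge hc ⟨_, h2⟩ ⟨_, h1⟩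

/-! ### The inverse Erlang loss function and its Laplace asymptotics. -/

/-- Half of the exponential absorbs the polynomial, through `y^s / s! ≤ exp y` at `y = x(1+t)/2`. -/
theorem exp_neg_mul_one_add_pow_le (s : ℕ) {x t : ℝ} (hx : 0 < x) (ht : 0 ≤ t) :
    Real.exp (-(x * t)) * (1 + t) ^ s ≤
      s.factorial * (2 / x) ^ s * Real.exp (x / 2) * Real.exp (-(x / 2) * t) := by
  have h := Real.pow_div_factorial_le_exp (x / 2 * (1 + t)) (by positivity) s
  rw [div_le_iff₀ (by positivity)] at h
  have h1 : (1 + t) ^ s = (2 / x) ^ s * (x / 2 * (1 + t)) ^ s := by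
    rw [← mul_pow]; congr 1; field_simp
  have h2 : Real.exp (x / 2) * Real.exp (-(x / 2) * t) =
      Real.exp (-(x * t)) * Real.exp (x / 2 * (1 + t)) := by
    rw [← Real.exp_add, ← Real.exp_add]; ring_nf
  rw [h1, mul_assoc _ (Real.exp (x / 2)), h2]
  calc _ ≤ Real.exp (-(x * t)) * ((2 / x) ^ s * (Real.exp (x / 2 * (1 + t)) * s.factorial)) := by
        gcongr
    _ = _ := by ring

theorem integrableOn_exp_neg_mul_one_add_pow (s : ℕ) {x : ℝ} (hx : 0 < x) :
    IntegrableOn (fun t : ℝ => Real.exp (-(x * t)) * (1 + t) ^ s) (Ioi 0) := by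
  refine ((integrableOn_exp_mul_Ioi (by linarith : -(x / 2) < 0) 0).const_mul
    (s.factorial * (2 / x) ^ s * Real.exp (x / 2))).mono' (by fun_prop) ?_
  refine (ae_restrict_iff' measurableSet_Ioi).2 (.of_forall fun t (ht : 0 < t) => ?_)
  rw [Real.norm_of_nonneg (by positivity)]
  exact exp_neg_mul_one_add_pow_le s hx ht.le

theorem tendsto_exp_neg_mul_one_add_pow (s : ℕ) {x : ℝ} (hx : 0 < x) :
    Tendsto (fun t : ℝ => Real.exp (-(x * t)) * (1 + t) ^ s) atTop (𝓝 0) := by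
  have h : Tendsto (fun t : ℝ => s.factorial * (2 / x) ^ s * Real.exp (x / 2) *
      Real.exp (-(x / 2) * t)) atTop (𝓝 0) := by
    rw [← mul_zero (s.factorial * (2 / x) ^ s * Real.exp (x / 2))]
    exact (Real.tendsto_exp_atBot.comp
      (tendsto_id.const_mul_atTop_of_neg (by linarith))).const_mul _
  refine squeeze_zero' ?_ ?_ h
  · filter_upwards [eventually_ge_atTop 0] with t ht
    positivity
  · filter_upwards [eventually_ge_atTop 0] with t ht
    exact exp_neg_mul_one_add_pow_le s hx ht

/-- The integral representation of the inverse Erlang loss function. -/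
theorem mul_integral_exp_neg_mul_one_add_pow (s : ℕ) {x : ℝ} (hx : 0 < x) :
    x * ∫ t in Ioi (0 : ℝ), Real.exp (-(x * t)) * (1 + t) ^ s =
      expPartial (s + 1) x / expTerm s x := by
  have hexp : ∀ t, HasDerivAt (fun t : ℝ => Real.exp (-(x * t))) (Real.exp (-(x * t)) * -x) t := by
    intro t
    have : HasDerivAt (fun t : ℝ => -(x * t)) (-x) t := by
      simpa using ((hasDerivAt_id' t).const_mul x).fun_neg
    exact this.exp
  induction s with
  | zero =>
    have h0 := integrableOn_exp_neg_mul_one_add_pow 0 hx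
    have h := integral_Ioi_of_hasDerivAt_of_tendsto' (a := 0)
      (f := fun t : ℝ => Real.exp (-(x * t)))
      (f' := fun t => -x * (Real.exp (-(x * t)) * (1 + t) ^ 0)) (m := 0)
      (fun t _ => (hexp t).congr_deriv (by ring))
      (h0.const_mul (-x)) (by simpa using tendsto_exp_neg_mul_one_add_pow 0 hx)
    rw [integral_const_mul] at h
    simp [expPartial, expTerm] at h ⊢
    linarith
  | succ s ih =>
    have h0 := integrableOn_exp_neg_mul_one_add_pow s hx
    have h1 := integrableOn_exp_neg_mul_one_add_pow (s + 1) hx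
    have hpow : ∀ t : ℝ, HasDerivAt (fun t : ℝ => (1 + t) ^ (s + 1)) ((s + 1) * (1 + t) ^ s) t := by
      intro t
      have := ((hasDerivAt_id' t).const_add 1).fun_pow (s + 1)
      simpa using this
    -- Integration by parts yields `x I_{s+1} = 1 + (s+1) I_s`, the recursion satisfied by the
    -- right-hand side.
    have h := integral_Ioi_of_hasDerivAt_of_tendsto' (a := 0)
      (f := fun t : ℝ => Real.exp (-(x * t)) * (1 + t) ^ (s + 1))
      (f' := fun t => (s + 1 : ℝ) * (Real.exp (-(x * t)) * (1 + t) ^ s) -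
        x * (Real.exp (-(x * t)) * (1 + t) ^ (s + 1))) (m := 0)
      (fun t _ => ((hexp t).mul (hpow t)).congr_deriv (by ring))
      (Integrable.sub' (h0.const_mul _) (h1.const_mul x)) (tendsto_exp_neg_mul_one_add_pow (s + 1) hx)
    rw [integral_sub (h0.const_mul _) (h1.const_mul x), integral_const_mul, integral_const_mul] at h
    have hA := expTerm_pos s hx
    have hA' := expTerm_pos (s + 1) hx
    have hrec := expTerm_succ s x
    have h2 : ∫ t in Ioi (0 : ℝ), Real.exp (-(x * t)) * (1 + t) ^ s =
        expPartial (s + 1) x / (expTerm s x * x) := by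
      rw [← div_div, ← ih, mul_div_cancel_left₀ _ hx.ne']
    rw [h2] at h
    have h3 : expTerm s x * x = (s + 1) * expTerm (s + 1) x := by rw [hrec, mul_comm]
    rw [h3] at h
    have h4 : (s + 1 : ℝ) * (expPartial (s + 1) x / ((s + 1) * expTerm (s + 1) x)) =
        expPartial (s + 1) x / expTerm (s + 1) x := by
      field_simp
    rw [h4] at h
    rw [expPartial_succ (s + 1), add_div, div_self hA'.ne']
    simp at h
    linarith

/-- The difference of the two sides has derivative `v² / (2(1+v)²)`. The bound is sharp to second
order at `0` and still gives linear decay at infinity. -/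
theorem log_one_add_le_sub {v : ℝ} (hv : 0 ≤ v) :
    Real.log (1 + v) ≤ v - v ^ 2 / (2 * (1 + v)) := by
  have hd : ∀ w : ℝ, 0 ≤ w → HasDerivAt
      (fun w : ℝ => w - w ^ 2 / (2 * (1 + w)) - Real.log (1 + w)) (w ^ 2 / (2 * (1 + w) ^ 2)) w := by
    intro w hw
    have h1 : HasDerivAt (fun w : ℝ => 1 + w) 1 w := (hasDerivAt_id' w).const_add 1
    have h2 := ((hasDerivAt_id' w).sub ((hasDerivAt_pow 2 w).div (h1.const_mul 2)
      (by positivity))).sub (h1.log (by positivity))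
    refine h2.congr_deriv ?_
    field_simp
    ring
  have hm : MonotoneOn (fun w : ℝ => w - w ^ 2 / (2 * (1 + w)) - Real.log (1 + w)) (Ici 0) := by
    refine monotoneOn_of_deriv_nonneg (convex_Ici 0)
      (fun w hw => (hd w hw).continuousAt.continuousWithinAt)
      (fun w hw => (hd w (interior_subset hw)).differentiableAt.differentiableWithinAt)
      fun w hw => ?_
    rw [(hd w (interior_subset hw)).deriv]
    positivity
  have := hm (mem_Ici.2 le_rfl) hv hv
  simp at this
  linarith

/-- The exponent of the scaled Erlang integrand: with `c = √s` this is
`s log (1 + u / c) - c u`. -/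
theorem sq_mul_log_le {c u : ℝ} (hc : 0 < c) (hu : 0 ≤ u) :
    c ^ 2 * Real.log (1 + u / c) - c * u ≤ -(u ^ 2 / (2 * (1 + u / c))) := by
  have h := mul_le_mul_of_nonneg_left (log_one_add_le_sub (div_nonneg hu hc.le)) (sq_nonneg c)
  have h2 : c ^ 2 * (u / c - (u / c) ^ 2 / (2 * (1 + u / c))) =
      c * u - u ^ 2 / (2 * (1 + u / c)) := by
    field_simp
  linarith

theorem le_sq_mul_log {c u : ℝ} (hc : 0 < c) (hu : 0 ≤ u) :
    -(u ^ 2 / (u / c + 2)) ≤ c ^ 2 * Real.log (1 + u / c) - c * u := by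
  have h := mul_le_mul_of_nonneg_left
    (Real.le_log_one_add_of_nonneg (div_nonneg hu hc.le)) (sq_nonneg c)
  have h2 : c ^ 2 * (2 * (u / c) / (u / c + 2)) = c * u - u ^ 2 / (u / c + 2) := by
    field_simp
    ring
  linarith

theorem tendsto_sq_mul_log {u : ℝ} (hu : 0 ≤ u) :
    Tendsto (fun c : ℝ => c ^ 2 * Real.log (1 + u / c) - c * u) atTop (𝓝 (-(u ^ 2 / 2))) := by
  have h0 : Tendsto (fun c : ℝ => u / c) atTop (𝓝 0) := tendsto_const_nhds.div_atTop tendsto_id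
  have hl : Tendsto (fun c : ℝ => -(u ^ 2 / (u / c + 2))) atTop (𝓝 (-(u ^ 2 / 2))) := by
    have := (tendsto_const_nhds (x := u ^ 2)).div (h0.add_const 2) (by norm_num)
    simpa using this.neg
  have hr : Tendsto (fun c : ℝ => -(u ^ 2 / (2 * (1 + u / c)))) atTop (𝓝 (-(u ^ 2 / 2))) := by
    have := (tendsto_const_nhds (x := u ^ 2)).div ((h0.const_add 1).const_mul 2) (by norm_num)
    simpa using this.neg
  refine tendsto_of_tendsto_of_tendsto_of_le_of_le' hl hr ?_ ?_
  · filter_upwards [eventually_gt_atTop 0] with c hc using le_sq_mul_log hc hu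
  · filter_upwards [eventually_gt_atTop 0] with c hc using sq_mul_log_le hc hu

/-- A linear bound uniform in `c ≥ K`, with slope as steep as desired; it provides the dominating
function. -/
theorem neg_sq_div_le {c u K : ℝ} (hK : 0 < K) (hKc : K ≤ c) (hu : 0 ≤ u) :
    -(u ^ 2 / (2 * (1 + u / c))) ≤ -(K / 2) * u + K ^ 2 / 2 := by
  have hc := hK.trans_le hKc
  have h1 : u / c ≤ u / K := div_le_div_of_nonneg_left hu hK hKc
  have h2 : u ^ 2 / (2 * (1 + u / K)) ≤ u ^ 2 / (2 * (1 + u / c)) := by gcongr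
  have h3 : K / 2 * u - K ^ 2 / 2 ≤ u ^ 2 / (2 * (1 + u / K)) := by
    rw [le_div_iff₀ (by positivity)]
    have : (K / 2 * u - K ^ 2 / 2) * (2 * (1 + u / K)) = u ^ 2 - K ^ 2 := by
      field_simp
      ring
    nlinarith [sq_nonneg K]
  linarith

theorem scaled_integrand_eq {s : ℕ} (hs : 0 < s) (b : ℝ) {u : ℝ} (hu : 0 ≤ u) :
    Real.exp (-((s - b * √(s : ℝ)) * ((√(s : ℝ))⁻¹ * u))) * (1 + (√(s : ℝ))⁻¹ * u) ^ s =
      Real.exp (b * u + (√(s : ℝ) ^ 2 * Real.log (1 + u / √(s : ℝ)) - √(s : ℝ) * u)) := by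
  have hc : 0 < √(s : ℝ) := Real.sqrt_pos.2 (by exact_mod_cast hs)
  have hsq : (s : ℝ) = √(s : ℝ) ^ 2 := (Real.sq_sqrt (Nat.cast_nonneg s)).symm
  have h1 : 0 < 1 + u / √(s : ℝ) := by positivity
  have h2 : (1 + (√(s : ℝ))⁻¹ * u) ^ s = Real.exp (√(s : ℝ) ^ 2 * Real.log (1 + u / √(s : ℝ))) := by
    rw [← hsq, ← Real.log_pow, Real.exp_log (pow_pos h1 s), inv_mul_eq_div]
  rw [h2, ← Real.exp_add]
  congr 1
  have h3 : ((s : ℝ) - b * √(s : ℝ)) * ((√(s : ℝ))⁻¹ * u) = √(s : ℝ) * u - b * u := by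
    nth_rewrite 1 [hsq]
    field_simp
  rw [h3]
  ring

theorem tendsto_scaled_integral {b : ℕ → ℝ} {β : ℝ} (hb : Tendsto b atTop (𝓝 β)) :
    Tendsto (fun s : ℕ => ∫ u in Ioi (0 : ℝ),
      Real.exp (-((s - b s * √(s : ℝ)) * ((√(s : ℝ))⁻¹ * u))) * (1 + (√(s : ℝ))⁻¹ * u) ^ s)
      atTop (𝓝 (halfMoment 0 β)) := by
  have hsqrt : Tendsto (fun s : ℕ => √(s : ℝ)) atTop atTop :=
    Real.tendsto_sqrt_atTop.comp tendsto_natCast_atTop_atTop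
  -- The slope `K/2 = (|β| + 1) + 1` absorbs the drift `b s ≤ |β| + 1` and leaves `exp (-u)`.
  set K : ℝ := 2 * |β| + 4 with hK
  have hK0 : 0 < K := by positivity
  refine tendsto_integral_filter_of_dominated_convergence
    (fun u => Real.exp (K ^ 2 / 2) * (u ^ 0 * Real.exp (-u))) (.of_forall fun s => by fun_prop)
    ?_ ((integrableOn_pow_mul_exp_neg 0).const_mul _) ?_
  · filter_upwards [eventually_gt_atTop 0, hsqrt.eventually_ge_atTop K,
      hb.eventually_lt_const (lt_add_one β)] with s hs hsK hbs
    refine (ae_restrict_iff' measurableSet_Ioi).2 (.of_forall fun u (hu : 0 < u) => ?_)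
    rw [scaled_integrand_eq hs _ hu.le, Real.norm_of_nonneg (Real.exp_pos _).le, pow_zero, one_mul,
      ← Real.exp_add, Real.exp_le_exp]
    have h1 := sq_mul_log_le (hK0.trans_le hsK) hu.le
    have h2 := neg_sq_div_le hK0 hsK hu.le
    have h3 : b s * u ≤ (|β| + 1) * u :=
      mul_le_mul_of_nonneg_right (by linarith [le_abs_self β]) hu.le
    have h4 : -(K / 2) * u = -(|β| + 1) * u - u := by rw [hK]; ring
    linarith
  · refine (ae_restrict_iff' measurableSet_Ioi).2 (.of_forall fun u (hu : 0 < u) => ?_)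
    have h := (hb.mul_const u).add ((tendsto_sq_mul_log hu.le).comp hsqrt)
    have h' := (Real.continuous_exp.tendsto _).comp h
    rw [pow_zero, one_mul, sub_eq_add_neg]
    refine h'.congr' ?_
    filter_upwards [eventually_gt_atTop 0] with s hs
    rw [scaled_integrand_eq hs _ hu.le]
    rfl

/-- In the Halfin–Whitt regime `x = s - β √s`, the ratio of the probabilities of `[0, s)` and `{s}`
is asymptotic to `√s Φ(β) / φ(β)`. -/
theorem tendsto_expPartial_div {b : ℕ → ℝ} {β : ℝ} (hb : Tendsto b atTop (𝓝 β)) :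
    Tendsto (fun s : ℕ => expPartial s (s - b s * √(s : ℝ)) /
      (expTerm s (s - b s * √(s : ℝ)) * √(s : ℝ))) atTop (𝓝 (halfMoment 0 β)) := by
  have hsqrt : Tendsto (fun s : ℕ => √(s : ℝ)) atTop atTop :=
    Real.tendsto_sqrt_atTop.comp tendsto_natCast_atTop_atTop
  have h0 := hb.div_atTop hsqrt
  have h1 := (tendsto_const_nhds (x := (1 : ℝ))).div_atTop hsqrt
  -- The factor `1 - b/√s` is `x/s`; subtracting `1/√s` removes the term `k = s`, which the integral
  -- formula includes.
  have h := ((h0.const_sub 1).mul (tendsto_scaled_integral hb)).sub h1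
  rw [sub_zero, sub_zero, one_mul] at h
  refine h.congr' ?_
  filter_upwards [eventually_gt_atTop 0, h0.eventually_lt_const one_pos] with s hs hbs
  have hc : 0 < √(s : ℝ) := Real.sqrt_pos.2 (by exact_mod_cast hs)
  have hsq : (s : ℝ) = √(s : ℝ) * √(s : ℝ) := (Real.mul_self_sqrt (Nat.cast_nonneg s)).symm
  set x : ℝ := s - b s * √(s : ℝ) with hx
  have hxs : (1 - b s / √(s : ℝ)) * √(s : ℝ) * √(s : ℝ) = x := by
    rw [hx]
    nth_rewrite 4 [hsq]
    field_simp
  have hx0 : 0 < x := by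
    rw [← hxs]
    have := sub_pos.2 hbs
    positivity
  have hA := expTerm_pos s hx0
  have hint := mul_integral_exp_neg_mul_one_add_pow s hx0
  have hcv := integral_comp_mul_left_Ioi
    (fun t : ℝ => Real.exp (-(x * t)) * (1 + t) ^ s) 0 (inv_pos.2 hc)
  rw [mul_zero, inv_inv, smul_eq_mul] at hcv
  rw [expPartial_succ, add_div, div_self hA.ne', ← sub_eq_iff_eq_add] at hint
  rw [hcv, ← div_div, ← hint]
  generalize ∫ t in Ioi (0 : ℝ), Real.exp (-(x * t)) * (1 + t) ^ s = J
  rw [← hxs]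
  field_simp

end Gaussian

/-! ### Limits in the regime `x = s - b√s`. -/

section HalfinWhitt

variable {q : ℕ → ℝ} {b : ℕ → ℝ} {β : ℝ}

theorem tendsto_sqrt_natCast_atTop : Tendsto (fun s : ℕ => √(s : ℝ)) atTop atTop :=
  Real.tendsto_sqrt_atTop.comp tendsto_natCast_atTop_atTop

theorem tendsto_sub_mul_sqrt_div (hb : Tendsto b atTop (𝓝 β)) :
    Tendsto (fun s : ℕ => (s - b s * √(s : ℝ)) / s) atTop (𝓝 1) := by
  have h := (hb.div_atTop tendsto_sqrt_natCast_atTop).const_sub 1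
  rw [sub_zero] at h
  refine h.congr' ?_
  filter_upwards [eventually_gt_atTop 0] with s hs
  have hc : 0 < √(s : ℝ) := Real.sqrt_pos.2 (by exact_mod_cast hs)
  have hs' : (s : ℝ) ≠ 0 := by positivity
  rw [sub_div, div_self hs', mul_div_assoc, Real.sqrt_div_self, div_eq_mul_inv]

theorem tendsto_waitSeries (hq : ∀ n, q n ∈ Set.Icc (0 : ℝ) 1) (hF : PolicyCondition q)
    (hb : Tendsto b atTop (𝓝 β)) :
    Tendsto (fun s : ℕ => waitSeries q ((s - b s * √(s : ℝ)) / s)) atTop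
      (𝓝 (waitSeries q 1)) :=
  (hF.continuousAt_waitSeries_one hq).tendsto.comp (tendsto_sub_mul_sqrt_div hb)

/-- The load `x/s` tends to `1` and `P < 1`, so stability survives even when `b` is negative and `x`
exceeds `s`. -/
theorem eventually_isStable (hF : PolicyCondition q) (hb : Tendsto b atTop (𝓝 β)) :
    ∀ᶠ s : ℕ in atTop, IsStable q s (s - b s * √(s : ℝ)) ∧ 0 < s - b s * √(s : ℝ) := by
  have h := tendsto_sub_mul_sqrt_div hb
  have h1 := h.mul_const (policyP q)
  rw [one_mul] at h1
  filter_upwards [eventually_gt_atTop 0, h.eventually_const_lt one_pos,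
    h1.eventually_lt_const hF.mem_Ico.2] with s hs h2 h3
  have h4 : 0 < s - b s * √(s : ℝ) := (div_pos_iff_of_pos_right (by exact_mod_cast hs)).1 h2
  exact ⟨(isStable_iff hF.mem_Ico.1 hs _).2 ⟨h4.le, h3⟩, h4⟩

/-- The waiting states add only `waitSeries / √s`, so the policy drops out of the limit. -/
theorem tendsto_scaled_totalWeight (hq : ∀ n, q n ∈ Set.Icc (0 : ℝ) 1) (hF : PolicyCondition q)
    (hb : Tendsto b atTop (𝓝 β)) :
    Tendsto (fun s : ℕ => totalWeight q s (s - b s * √(s : ℝ)) /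
      (expTerm s (s - b s * √(s : ℝ)) * √(s : ℝ))) atTop (𝓝 (halfMoment 0 β)) := by
  have h := (tendsto_expPartial_div hb).add
    ((tendsto_waitSeries hq hF hb).div_atTop tendsto_sqrt_natCast_atTop)
  rw [add_zero] at h
  refine h.congr' ?_
  filter_upwards [eventually_isStable hF hb] with s hs
  rw [totalWeight, add_div, mul_div_mul_left _ _ (expTerm_pos s hs.2).ne']

theorem tendsto_freeServers_div (hq : ∀ n, q n ∈ Set.Icc (0 : ℝ) 1) (hF : PolicyCondition q)
    (hb : Tendsto b atTop (𝓝 β)) :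
    Tendsto (fun s : ℕ => freeServers s (s - b s * √(s : ℝ)) /
      totalWeight q s (s - b s * √(s : ℝ)) / √(s : ℝ)) atTop (𝓝 (β + phi β / Phi β)) := by
  have hm := halfMoment_pos 0 β
  have h := ((hb.mul (tendsto_expPartial_div hb)).add_const 1).div
    (tendsto_scaled_totalWeight hq hF hb) hm.ne'
  rw [phi_div_Phi, add_one_div_halfMoment, halfMoment_one]
  refine h.congr' ?_
  filter_upwards [eventually_gt_atTop 0, eventually_isStable hF hb] with s hs0 hs
  have hA := expTerm_pos s hs.2
  have hD := totalWeight_pos hq hs0 hs.2.le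
  have hc : 0 < √(s : ℝ) := Real.sqrt_pos.2 (by exact_mod_cast hs0)
  have hsq : (s : ℝ) = √(s : ℝ) * √(s : ℝ) := (Real.mul_self_sqrt (Nat.cast_nonneg s)).symm
  have hN : freeServers s (s - b s * √(s : ℝ)) = b s * √(s : ℝ) *
      expPartial s (s - b s * √(s : ℝ)) +
        √(s : ℝ) * √(s : ℝ) * expTerm s (s - b s * √(s : ℝ)) := by
    rw [freeServers_eq, ← hsq, sub_sub_cancel]
  rw [hN]
  simp only [Pi.div_apply]
  generalize expTerm s (s - b s * √(s : ℝ)) = A at *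
  generalize totalWeight q s (s - b s * √(s : ℝ)) = D at *
  field_simp

theorem tendsto_sqrt_mul_delayProb (hq : ∀ n, q n ∈ Set.Icc (0 : ℝ) 1) (hF : PolicyCondition q)
    (hb : Tendsto b atTop (𝓝 β)) :
    Tendsto (fun s : ℕ => √(s : ℝ) * delayProb q s (s - b s * √(s : ℝ))) atTop
      (𝓝 ((1 + policySeries q 1) * (phi β / Phi β))) := by
  have h := (tendsto_waitSeries hq hF hb).div (tendsto_scaled_totalWeight hq hF hb)
    (halfMoment_pos 0 β).ne'
  rw [waitSeries_eq_one_add (summable_admitProd_mul_pow hq zero_le_one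
    (by simpa using hF.mem_Ico.2) hF.mem_Ico.1)] at h
  rw [phi_div_Phi, mul_one_div]
  refine h.congr' ?_
  filter_upwards [eventually_gt_atTop 0, eventually_isStable hF hb] with s hs0 hs
  have hA := expTerm_pos s hs.2
  have hD := totalWeight_pos hq hs0 hs.2.le
  have hc : 0 < √(s : ℝ) := Real.sqrt_pos.2 (by exact_mod_cast hs0)
  rw [delayProb_eq hs0 (hs.1.summable hq hF hs0)]
  simp only [Pi.div_apply]
  field_simp

end HalfinWhitt

/-! ### Convergence of the scaled Cohen solution. -/

section CohenLimit

variable {q : ℕ → ℝ} {γ β : ℝ} {Om : ℕ → ℝ}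

theorem sub_add_eq_sub_mul_sqrt {s : ℕ} (hs : 0 < s) (γ Om : ℝ) :
    s - γ * √(s : ℝ) + Om = s - (γ - Om / √(s : ℝ)) * √(s : ℝ) := by
  have hc : 0 < √(s : ℝ) := Real.sqrt_pos.2 (by exact_mod_cast hs)
  field_simp
  ring

/-- Monotonicity of the expected number of free servers pins down the scaled Cohen solution. -/
theorem tendsto_sub_cohenSolution (hq : ∀ n, q n ∈ Set.Icc (0 : ℝ) 1) (hF : PolicyCondition q)
    (hβ : β + phi β / Phi β = γ)
    (hOm : ∀ᶠ s : ℕ in atTop, IsCohenSolution q s (s - γ * √(s : ℝ)) (Om s)) :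
    Tendsto (fun s : ℕ => γ - Om s / √(s : ℝ)) atTop (𝓝 β) := by
  have key : ∀ᶠ s : ℕ in atTop, 0 < s ∧ 0 < √(s : ℝ) ∧
      IsStable q s (s - (γ - Om s / √(s : ℝ)) * √(s : ℝ)) ∧
      freeServers s (s - (γ - Om s / √(s : ℝ)) * √(s : ℝ)) /
        totalWeight q s (s - (γ - Om s / √(s : ℝ)) * √(s : ℝ)) = γ * √(s : ℝ) := by
    filter_upwards [eventually_gt_atTop 0, hOm] with s hs h
    have h1 := (isCohenSolution_iff hq hF hs).1 h
    rw [sub_add_eq_sub_mul_sqrt hs, sub_sub_cancel] at h1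
    exact ⟨hs, Real.sqrt_pos.2 (by exact_mod_cast hs), h1⟩
  refine tendsto_order.2 ⟨fun l hl => ?_, fun l hl => ?_⟩
  -- Comparison with the constant sequence `l < β`: at `s - l√s` the value of `N` is eventually
  -- below `γ√s`, so the Cohen point must lie strictly to its left. No prior bound on `Om s / √s` is
  -- needed.
  · have h1 := (tendsto_freeServers_div hq hF (tendsto_const_nhds (x := l))).eventually_lt_const
      ((add_phi_div_Phi_lt hl).trans_eq hβ)
    filter_upwards [key, h1, eventually_isStable hF (tendsto_const_nhds (x := l))]
      with s ⟨hs, hc, hst, heq⟩ h2 h3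
    by_contra! hcon
    rw [div_lt_iff₀ hc, ← heq] at h2
    rcases hcon.eq_or_lt with h | h
    · rw [h] at h2
      exact lt_irrefl _ h2
    · exact lt_asymm h2 (hst.freeServers_div_lt hq hF hs h3.1.1
        (sub_lt_sub_left (mul_lt_mul_of_pos_right h hc) _))
  · have h1 := (tendsto_freeServers_div hq hF (tendsto_const_nhds (x := l))).eventually_const_lt
      (hβ.symm.trans_lt (add_phi_div_Phi_lt hl))
    filter_upwards [key, h1, eventually_isStable hF (tendsto_const_nhds (x := l))]
      with s ⟨hs, hc, hst, heq⟩ h2 h3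
    by_contra! hcon
    rw [lt_div_iff₀ hc, ← heq] at h2
    rcases hcon.eq_or_lt with h | h
    · rw [← h] at h2
      exact lt_irrefl _ h2
    · exact lt_asymm h2 (h3.1.freeServers_div_lt hq hF hs hst.1
        (sub_lt_sub_left (mul_lt_mul_of_pos_right h hc) _))

/-- The Cohen equation itself gives `√s D^R = (Ω/√s) / ((λ+Ω)/s)`, whose denominator tends to `1`.
-/
theorem tendsto_sqrt_mul_rejectProb (hF : PolicyCondition q) {a : ℝ}
    (ha : Tendsto (fun s : ℕ => Om s / √(s : ℝ)) atTop (𝓝 a))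
    (hOm : ∀ᶠ s : ℕ in atTop, IsCohenSolution q s (s - γ * √(s : ℝ)) (Om s)) :
    Tendsto (fun s : ℕ => √(s : ℝ) * rejectProb q s (s - γ * √(s : ℝ) + Om s)) atTop (𝓝 a) := by
  have hb := ha.const_sub γ
  have h := ha.div (tendsto_sub_mul_sqrt_div hb) one_ne_zero
  rw [div_one] at h
  refine h.congr' ?_
  filter_upwards [eventually_gt_atTop 0, hOm, eventually_isStable hF hb] with s hs h1 h2
  have heq := h1.equation
  rw [← sub_add_eq_sub_mul_sqrt hs] at h2
  have hc : 0 < √(s : ℝ) := Real.sqrt_pos.2 (by exact_mod_cast hs)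
  have hsq : (s : ℝ) = √(s : ℝ) * √(s : ℝ) := (Real.mul_self_sqrt (Nat.cast_nonneg s)).symm
  simp only [Pi.div_apply]
  rw [← sub_add_eq_sub_mul_sqrt hs]
  generalize (s : ℝ) - γ * √(s : ℝ) + Om s = x at *
  rw [div_div_eq_mul_div, heq, div_mul_eq_mul_div, div_div, div_eq_iff (by have := h2.2; positivity)]
  nth_rewrite 1 [hsq]
  ring

end CohenLimit

end RetrialQueue
end

open RetrialQueue in
theorem mainTheorem2 (q : ℕ → ℝ) (hq : ∀ n, q n ∈ Set.Icc (0 : ℝ) 1) (hF : PolicyCondition q)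
    (γ : ℝ) (hγ : 0 < γ) :
    (∀ s : ℕ, γ ≤ √(s : ℝ) → ∃! Om : ℝ, IsCohenSolution q s (s - γ * √(s : ℝ)) Om) ∧
    ∃ a : ℝ, (0 < a ∧ a = phi (γ - a) / Phi (γ - a)) ∧
      (∀ b : ℝ, 0 < b → b = phi (γ - b) / Phi (γ - b) → b = a) ∧
      ∀ Om : ℕ → ℝ,
        (∀ᶠ s : ℕ in atTop, IsCohenSolution q s (s - γ * √(s : ℝ)) (Om s)) →
        Tendsto (fun s : ℕ => Om s / √(s : ℝ)) atTop (𝓝 a) ∧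
        Tendsto (fun s : ℕ => √(s : ℝ) * delayProb q s (s - γ * √(s : ℝ) + Om s)) atTop
          (𝓝 ((1 + policySeries q 1) * (phi (γ - a) / Phi (γ - a)))) ∧
        Tendsto (fun s : ℕ => √(s : ℝ) * rejectProb q s (s - γ * √(s : ℝ) + Om s)) atTop
          (𝓝 (phi (γ - a) / Phi (γ - a))) := by
  refine ⟨fun s hγs => ?_, ?_⟩
  · have hc : 0 < √(s : ℝ) := hγ.trans_le hγs
    have hs : 0 < s := by exact_mod_cast Real.sqrt_pos.1 hc
    refine existsUnique_isCohenSolution hq hF hs (sub_nonneg.2 ?_)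
      (sub_lt_self _ (mul_pos hγ hc))
    calc γ * √(s : ℝ) ≤ √(s : ℝ) * √(s : ℝ) := by gcongr
      _ = s := Real.mul_self_sqrt (Nat.cast_nonneg s)
  -- The substitution `β = γ - a` turns the equation for `a` into `β + φ(β)/Φ(β) = γ`, whose left
  -- side is strictly increasing.
  · obtain ⟨β, hβ⟩ := exists_add_phi_div_Phi_eq hγ
    have ha : γ - β = phi β / Phi β := by linarith
    refine ⟨γ - β, ⟨ha ▸ phi_div_Phi_pos β, by rwa [sub_sub_cancel]⟩, fun b _ hb => ?_,
      fun Om hOm => ?_⟩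
    · rcases lt_trichotomy (γ - b) β with h | h | h
      · linarith [add_phi_div_Phi_lt h]
      · linarith
      · linarith [add_phi_div_Phi_lt h]
    · have hlim := tendsto_sub_cohenSolution hq hF hβ hOm
      have hlim' : Tendsto (fun s : ℕ => Om s / √(s : ℝ)) atTop (𝓝 (γ - β)) := by
        simpa using hlim.const_sub γ
      rw [sub_sub_cancel]
      refine ⟨hlim', ?_, ha ▸ tendsto_sqrt_mul_rejectProb hF hlim' hOm⟩
      refine (tendsto_sqrt_mul_delayProb hq hF hlim).congr' ?_
      filter_upwards [eventually_gt_atTop 0] with s hs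
      rw [sub_add_eq_sub_mul_sqrt hs]
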